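/- Let $S$ be an associative ring with identity, let $\mathbf P=(\Omega,\preccurlyeq)$ be a poset on a nonempty finite set $\Omega$, let $\omega:\Omega\to\mathbb R^{+}$ be a function with positive real values, let $(H_i\mid i\in\Omega)$ be a family of left $S$-modules, and let $\mathbf H=\prod_{i\in\Omega}H_i$. For $B\subseteq\Omega$ let $\langle B\rangle=\{a\in\Omega\mid \exists\, b\in B:\ a\preccurlyeq b\}$, and call $B$ an ideal of $\mathbf P$ if $\langle B\rangle=B$. For $y\in\Omega$ let $\mathrm{len}(y)$ be the largest cardinality of a chain in $\mathbf P$ with greatest element $y$, let $m$ be the largest cardinality of a chain in $\mathbf P$, and for $r\in\{1,\dots,m\}$ let $W_r=\{u\in\Omega\mid \mathrm{len}(u)=r\}$. For $\beta\in\mathbf H$ let $\mathrm{supp}(\beta)=\{i\in\Omega\mid\beta_i\ne0\}$ and $\mathrm{wt}(\beta)=\sum_{i\in\langle \mathrm{supp}(\beta)\rangle}\omega(i)$; this is the $(\mathbf P,\omega)$-weight. $\mathbf H$ satisfies the MacWilliams extension property (MEP) for $(\mathbf P,\omega)$-weight if for every $S$-submodule $C\subseteq\mathbf H$ and every $S$-linear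 map $f:C\to\mathbf H$ with $\mathrm{wt}(f(\alpha))=\mathrm{wt}(\alpha)$ for all $\alpha\in C$, there is an $S$-module automorphism $\varphi$ of $\mathbf H$ with $\mathrm{wt}(\varphi(\alpha))=\mathrm{wt}(\alpha)$ for all $\alpha\in\mathbf H$ and $\varphi|_C=f$. For a finite left $S$-module $X$ that has a non-cyclic submodule, let $\mu$ be the Möbius function of the lattice of $S$-submodules of $X$ ordered by inclusion, and let $$\zeta_S(X)=\min\Big\{\tfrac12\sum_{U\subseteq W}|\mu(U,W)|\ \Big|\ W \text{ a non-cyclic } S\text{-submodule of } X\Big\},$$ where $U$ runs over the submodules of $W$. The socle of a module is its largest semisimple submodule. **Theorem.** Suppose that: - $\mathbf P$ is hierarchical: for all $u,v\in\Omega$, if $\mathrm{len}(u)+1\le\mathrm{len}(v)$ then $u\preccurlyeq v$; - (A) every $H_i$ is strong pseudo-injective: each injective $S$-linear map $B\to H_i$ from a submodule $B\subseteq H_i$ extends to an $S$-module automorphism of $H_i$; - (B) for all $k\preccurlyeq l$ in $\Omega$ with $k\neq l$, $H_k$ is $H_l$-injective: each $S$-linear map $A\to H_k$ from a submodule $A\subseteq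 H_l$ extends to an $S$-linear map $H_l\to H_k$; - (D) $(\mathbf P,\omega)$ has the unique decomposition property: for any ideals $I,J$ of $\mathbf P$ with $\sum_{i\in I}\omega(i)=\sum_{j\in J}\omega(j)$ there is an order automorphism $\lambda$ of $\mathbf P$ with $J=\lambda[I]$ and $\omega(\lambda(i))=\omega(i)$ for all $i\in\Omega$; moreover, $H_u\cong H_v$ as $S$-modules whenever $\mathrm{len}(u)=\mathrm{len}(v)$ and $\omega(u)=\omega(v)$. Assume further that for every $r\in\{1,\dots,m\}$ and every $b\in\omega[W_r]$, writing $W_{r,b}=\{i\in W_r\mid\omega(i)=b\}$ and $X_{r,b}=\prod_{i\in W_{r,b}}H_i$, at least one of the following holds: 1. for every $i\in W_{r,b}$, $H_i$ is finite and its socle is cyclic; 2. all $S$-submodules of $X_{r,b}$ are cyclic; 3. $X_{r,b}$ is finite and has a non-cyclic $S$-submodule, and $|W_{r,b}|\le\zeta_S(X_{r,b})-1$; 4. $|W_{r,b}|\le2$; 5. for every proper (two-sided) ideal $Q$ of $S$, the quotient $S/Q$ is infinite. Then $\mathbf H$ satisfies the MEP for $(\mathbf P,\omega)$-weight. -/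

import Mathlib

namespace WeightedPoset

noncomputable section

/-! ## Finite posets -/

section Posets

variable {Ω : Type*} [Fintype Ω] [PartialOrder Ω]

/-- `len y` is the largest cardinality of a chain containing `y` as its greatest element. -/
def len (y : Ω) : ℕ :=
  sSup {n : ℕ | ∃ B : Finset Ω,
    IsChain (· ≤ ·) (B : Set Ω) ∧ IsGreatest (B : Set Ω) y ∧ B.card = n}

variable (Ω) in
/-- The largest cardinality of a chain in the poset. -/
def maxChainCard : ℕ :=
  sSup {n : ℕ | ∃ B : Finset Ω, IsChain (· ≤ ·) (B : Set Ω) ∧ B.card = n}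

variable (Ω) in
/-- The `r`-th level of the poset. -/
def level (r : ℕ) : Set Ω := {u | len u = r}

variable (Ω) in
/-- The poset is hierarchical: each element lies below all elements of higher levels. -/
def IsHierarchical : Prop := ∀ u v : Ω, len u + 1 ≤ len v → u ≤ v

/-- The unique decomposition property of a weighted poset; ideals of the poset are lower sets. -/
def UDP (ω : Ω → ℝ) : Prop :=
  ∀ I J : Finset Ω, IsLowerSet (I : Set Ω) → IsLowerSet (J : Set Ω) →
    ∑ i ∈ I, ω i = ∑ j ∈ J, ω j →
    ∃ σ : Ω ≃o Ω, (J : Set Ω) = σ '' (I : Set Ω) ∧ ∀ i, ω (σ i) = ω i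

end Posets

/-! ## Modules -/

section Modules

variable (S : Type*) [Ring S]

/-- `Y` is `X`-injective: homomorphisms from submodules of `X` to `Y` extend to `X`. -/
def IsRelInjective (X Y : Type*) [AddCommGroup X] [Module S X]
    [AddCommGroup Y] [Module S Y] : Prop :=
  ∀ (A : Submodule S X) (f : A →ₗ[S] Y), ∃ g : X →ₗ[S] Y, ∀ a : A, g a = f a

/-- `Y` is strong pseudo-injective: injective homomorphisms from submodules of `Y` to `Y`
extend to automorphisms of `Y`. -/
def IsStrongPseudoInjective (Y : Type*) [AddCommGroup Y] [Module S Y] : Prop :=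
  ∀ (B : Submodule S Y) (h : B →ₗ[S] Y), Function.Injective h →
    ∃ τ : Y ≃ₗ[S] Y, ∀ b : B, τ b = h b

/-- The socle: the largest semisimple submodule (see `isGreatest_socle`). -/
def socle (Y : Type*) [AddCommGroup Y] [Module S Y] : Submodule S Y :=
  sSup {N : Submodule S Y | IsSemisimpleModule S N}

theorem isGreatest_socle (Y : Type*) [AddCommGroup Y] [Module S Y] :
    IsGreatest {N : Submodule S Y | IsSemisimpleModule S N} (socle S Y) := by
  refine ⟨?_, fun N hN => le_sSup hN⟩
  have h := isSemisimpleModule_biSup_of_isSemisimpleModule_submodule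
    (s := {N : Submodule S Y | IsSemisimpleModule S N}) (p := fun N => N) (fun _ hN => hN)
  rw [← sSup_eq_iSup] at h
  exact h

open Classical in
/-- The Möbius function `μ(U, W)` of the submodule lattice of a finite module. -/
def submoduleMoebius (X : Type*) [AddCommGroup X] [Module S X] [Finite X]
    (U W : Submodule S X) : ℤ :=
  letI : Fintype (Submodule S X) := Fintype.ofFinite _
  letI : LocallyFiniteOrder (Submodule S X) := Fintype.toLocallyFiniteOrder
  IncidenceAlgebra.mu ℤ U W

open Classical in
/-- `ζ_S(X)`: the minimum, over all non-cyclic submodules `W` of the finite module `X`, of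
`(1/2) * ∑_{U ⊆ W} |μ(U, W)|`. It is only meaningful when `X` has a non-cyclic submodule; the
infimum is then taken over a nonempty finite set of reals. -/
def zetaNum (X : Type*) [AddCommGroup X] [Module S X] [Finite X] : ℝ :=
  letI : Fintype (Submodule S X) := Fintype.ofFinite _
  sInf {x : ℝ | ∃ W : Submodule S X, ¬ W.IsPrincipal ∧
    x = (1 / 2 : ℝ) * ∑ U : Submodule S X with U ≤ W, |(submoduleMoebius S X U W : ℝ)|}

end Modules

/-! ## Codes and the MacWilliams extension property -/

section Codes

/-- The support of a codeword. -/
def supp {Ω : Type*} {H : Ω → Type*} [∀ i, AddCommGroup (H i)] (β : ∀ i, H i) : Set Ω :=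
  {i | β i ≠ 0}

variable (S : Type*) [Ring S] {Ω : Type*} [Fintype Ω] [PartialOrder Ω]
  (H : Ω → Type*) [∀ i, AddCommGroup (H i)] [∀ i, Module S (H i)] (ω : Ω → ℝ)

variable {H} in
open Classical in
/-- The weight of a codeword: the total weight of the ideal generated by its support. -/
def wt (β : ∀ i, H i) : ℝ := ∑ i : Ω with i ∈ lowerClosure (supp β), ω i

/-- The MacWilliams extension property of `∏ i, H i` for the weight of the weighted poset. -/
def MEP : Prop :=
  ∀ (C : Submodule S (∀ i, H i)) (f : C →ₗ[S] (∀ i, H i)),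
    (∀ α : C, wt ω (f α) = wt ω (α : ∀ i, H i)) →
    ∃ φ : (∀ i, H i) ≃ₗ[S] (∀ i, H i),
      (∀ α, wt ω (φ α) = wt ω α) ∧ ∀ α : C, φ α = f α

/-- Every `H i` is strong pseudo-injective. -/
def ConditionA : Prop := ∀ i, IsStrongPseudoInjective S (H i)

/-- `H k` is `H l`-injective whenever `k` lies strictly below `l`. -/
def ConditionB : Prop := ∀ k l : Ω, k ≤ l → k ≠ l → IsRelInjective S (H l) (H k)

/-- The weighted poset has the UDP, and `H u`, `H v` are isomorphic whenever `u`, `v` have the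
same level and the same weight. -/
def ConditionD : Prop :=
  UDP ω ∧ ∀ u v : Ω, len u = len v → ω u = ω v → Nonempty (H u ≃ₗ[S] H v)

/-- The positions of level `r` and weight `b`. -/
def block (r : ℕ) (b : ℝ) : Set Ω := {i | i ∈ level Ω r ∧ ω i = b}

/-- The product of the modules over the positions of level `r` and weight `b`. -/
abbrev BlockModule (r : ℕ) (b : ℝ) : Type _ := ∀ i : block ω r b, H i

end Codes

end

end WeightedPoset

/-! In a hierarchical poset a nonzero coordinate absorbs everything on lower levels. With unique
decomposition, the weight of a word that vanishes above level `r` therefore determines its number of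
zeros on each block of level `r` (positions with equal `len` and equal `ω`). So `f` acts on leading
terms, block by block, as a Hamming isometry. If these isometries are monomial, they glue to a
weight-preserving monomial map `φ` (`exists_leading_monomial`). At coordinate `k`, `φ⁻¹ ∘ f` then
differs from the inclusion by a map that vanishes on codewords vanishing above `k`. Relative
injectivity writes this difference as a sum of maps of the higher coordinates
(`exists_sum_extension`), so `φ⁻¹ ∘ f` is the restriction of a unitriangular automorphism, and those
preserve weight.

The Hamming problem is a cancellation problem: the kernels of the coordinate maps of two isometric
families contain each point equally often, and they must agree as multisets; strong
pseudo-injectivity then matches the coordinates. Cancelling common members leaves disjoint multisets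
with equal counts, to be shown empty. Otherwise a maximal member is covered by members of the other
multiset, none containing it. This is impossible for cyclic submodules, for covers by at most two,
and, by Neumann's finite-index lemma, when all proper quotients of `S` are infinite. Cyclic socles
supply generating characters, and summing these against the counts forces equality
(`SameCounts.eq_of_characters`). The bound by `zetaNum` comes from Möbius inversion
(`SameCounts.eq_of_card_lt_zetaNum`). -/

namespace WeightedPoset

open Multiset

/-! ### Multisets of submodules with equal incidence counts -/

section Cancellation

variable {S M : Type*} [Ring S] [AddCommGroup M] [Module S M]

open Classical in
/-- Two multisets of submodules have the same incidence counts at each point. -/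
def SameCounts (s t : Multiset (Submodule S M)) : Prop :=
  ∀ x : M, s.countP (x ∈ ·) = t.countP (x ∈ ·)

theorem SameCounts.symm {s t : Multiset (Submodule S M)} (h : SameCounts s t) :
    SameCounts t s := fun x => (h x).symm

theorem SameCounts.card_eq {s t : Multiset (Submodule S M)} (h : SameCounts s t) :
    s.card = t.card := by
  classical
  -- Zero lies in every submodule, so its count is the size of the multiset.
  have h0 := h 0
  rwa [countP_eq_card.2 fun K _ => K.zero_mem, countP_eq_card.2 fun K _ => K.zero_mem] at h0

/-- Cancelling the common part reduces equality of multisets to the disjoint case. -/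
theorem SameCounts.eq_of_disjoint {s t : Multiset (Submodule S M)} (h : SameCounts s t)
    (H : ∀ s' ≤ s, ∀ t' ≤ t, (∀ K ∈ s', K ∉ t') → SameCounts s' t' → s' = 0) : s = t := by
  classical
  have hs := sub_add_inter s t
  have ht := sub_add_inter t s
  have hd : ∀ K ∈ s - t, K ∉ t - s := by
    intro K h1 h2
    have h1 := count_pos.2 h1
    have h2 := count_pos.2 h2
    rw [count_sub] at h1 h2
    omega
  have hc : SameCounts (s - t) (t - s) := by
    intro x
    have hx := h x
    have h1 := congrArg (countP (x ∈ ·)) hs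
    have h2 := congrArg (countP (x ∈ ·)) ht
    rw [countP_add] at h1 h2
    rw [Multiset.inter_comm t s] at h2
    rw [← h1, ← h2] at hx
    exact Nat.add_right_cancel hx
  have h1 := H _ tsub_le_self _ tsub_le_self hd hc
  have h2 : t - s = 0 := by rw [← card_eq_zero, ← hc.card_eq, h1, card_zero]
  rw [h1] at hs
  rw [h2, Multiset.inter_comm t s] at ht
  exact hs.symm.trans ht

/-- A maximal member of two disjoint multisets with equal counts is covered by submodules not
containing it. -/
theorem SameCounts.exists_cover {s t : Multiset (Submodule S M)} (h : SameCounts s t)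
    (hd : ∀ K ∈ s, K ∉ t) (hs : s ≠ 0) :
    ∃ (K : Submodule S M) (F : Finset (Submodule S M)), F.card ≤ s.card ∧
      (∀ L ∈ F, ¬ K ≤ L) ∧ ∀ x ∈ K, ∃ L ∈ F, x ∈ L := by
  classical
  obtain ⟨K₀, hK₀⟩ := exists_mem_of_ne_zero hs
  obtain ⟨K, hK, hmax⟩ := (s + t).toFinset.exists_maximal
    ⟨K₀, by simp [hK₀]⟩
  -- The maximal `K` may come from either side, so the argument is stated for an ordered pair `u`,
  -- `v`.
  have key : ∀ u v : Multiset (Submodule S M), SameCounts u v → (∀ K ∈ u, K ∉ v) →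
      (∀ L ∈ v, L ∈ s + t) → K ∈ u →
      ∃ F : Finset (Submodule S M), F.card ≤ u.card ∧
      (∀ L ∈ F, ¬ K ≤ L) ∧ ∀ x ∈ K, ∃ L ∈ F, x ∈ L := by
    intro u v huv hd' hsub hKu
    refine ⟨v.toFinset, huv.card_eq ▸ toFinset_card_le v, fun L hL hKL => ?_, fun x hx => ?_⟩
    · have hL' := mem_toFinset.1 hL
      have := hmax (mem_toFinset.2 (hsub L hL')) hKL
      exact hd' K hKu (le_antisymm hKL this ▸ hL')
    · have : 0 < u.countP (x ∈ ·) := countP_pos.2 ⟨K, hKu, hx⟩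
      rw [huv x] at this
      obtain ⟨L, hL, hxL⟩ := countP_pos.1 this
      exact ⟨L, mem_toFinset.2 hL, hxL⟩
  rw [mem_toFinset, Multiset.mem_add] at hK
  rcases hK with hK | hK
  · exact ⟨K, key s t h hd (fun L hL => by simp [hL]) hK⟩
  · obtain ⟨F, hF⟩ := key t s h.symm (fun K h1 h2 => hd K h2 h1) (fun L hL => by simp [hL]) hK
    exact ⟨K, F, h.card_eq ▸ hF⟩

open Classical in
/-- Disjoint multisets are distinguished by the number of members above some submodule. -/
theorem exists_countP_le_ne {s t : Multiset (Submodule S M)}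
    (hd : ∀ K ∈ s, K ∉ t) (hs : s ≠ 0) :
    ∃ V : Submodule S M, s.countP (V ≤ ·) ≠ t.countP (V ≤ ·) := by
  by_contra! hcon
  obtain ⟨K₀, hK₀⟩ := exists_mem_of_ne_zero hs
  obtain ⟨K, hK, hmax⟩ := (s + t).toFinset.exists_maximal ⟨K₀, by simp [hK₀]⟩
  have key : ∀ u v : Multiset (Submodule S M), u.countP (K ≤ ·) = v.countP (K ≤ ·) →
      (∀ K ∈ u, K ∉ v) → (∀ L ∈ v, L ∈ s + t) → K ∈ u → False := by
    intro u v huv hd' hsub hKu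
    have : 0 < u.countP (K ≤ ·) := countP_pos.2 ⟨K, hKu, le_rfl⟩
    rw [huv] at this
    obtain ⟨L, hL, hKL⟩ := countP_pos.1 this
    exact hd' K hKu (le_antisymm hKL (hmax (mem_toFinset.2 (hsub L hL)) hKL) ▸ hL)
  rw [mem_toFinset, Multiset.mem_add] at hK
  rcases hK with hK | hK
  · exact key s t (hcon K) hd (fun L hL => by simp [hL]) hK
  · exact key t s (hcon K).symm (fun K h1 h2 => hd K h2 h1) (fun L hL => by simp [hL]) hK

/-- A covering submodule that contains a generator of `K` contains all of `K`. -/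
theorem SameCounts.eq_of_forall_isPrincipal {s t : Multiset (Submodule S M)}
    (h : SameCounts s t) (hp : ∀ N : Submodule S M, N.IsPrincipal) : s = t := by
  refine h.eq_of_disjoint fun s' _ t' _ hd hc => by_contra fun h0 => ?_
  obtain ⟨K, F, -, hF, hcov⟩ := hc.exists_cover hd h0
  obtain ⟨x, rfl⟩ := hp K
  obtain ⟨L, hL, hx⟩ := hcov x (Submodule.mem_span_singleton_self x)
  exact hF L hL ((Submodule.span_singleton_le_iff_mem x L).2 hx)

/-- A group contained in the union of two subgroups lies in one of them. -/
theorem SameCounts.eq_of_card_le_two {s t : Multiset (Submodule S M)}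
    (h : SameCounts s t) (h2 : s.card ≤ 2) : s = t := by
  refine h.eq_of_disjoint fun s' hs' t' _ hd hc => by_contra fun h0 => ?_
  obtain ⟨K, F, hcard, hF, hcov⟩ := hc.exists_cover hd h0
  have hFc : F.card ≤ 2 := hcard.trans ((card_le_card hs').trans h2)
  obtain ⟨A, B, hAB⟩ : ∃ A B : Submodule S M, (¬ K ≤ A) ∧ (¬ K ≤ B) ∧ ∀ x ∈ K, x ∈ A ∨ x ∈ B := by
    obtain ⟨L₀, hL₀, -⟩ := hcov 0 K.zero_mem
    have : F.card = 1 ∨ F.card = 2 := by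
      have := Finset.card_pos.2 ⟨L₀, hL₀⟩
      omega
    rcases this with h1 | h1
    · obtain ⟨A, rfl⟩ := Finset.card_eq_one.1 h1
      exact ⟨A, A, by simpa using hF, by simpa using hF, by simpa using hcov⟩
    · classical
      obtain ⟨A, B, -, rfl⟩ := Finset.card_eq_two.1 h1
      exact ⟨A, B, hF A (by simp), hF B (by simp), by simpa using hcov⟩
  obtain ⟨hA, hB, hcov⟩ := hAB
  have : (K : Set M) ⊆ (A : Set M) ∪ (B : Set M) := hcov
  rcases AddSubgroupClass.subset_union.1 this with h | h
  · exact hA h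
  · exact hB h

/-- By Neumann's lemma, some member `L` of a finite cover of `K` meets `K` in finite index. The
annihilator `Q` of the finite nonzero module `K / (K ∩ L)` is a proper two-sided ideal, and `S / Q`
embeds into the finite set of self-maps of that module. -/
theorem SameCounts.eq_of_infinite_quotients {s t : Multiset (Submodule S M)}
    (h : SameCounts s t) (hQ : ∀ Q : Ideal S, Q.IsTwoSided → Q ≠ ⊤ → Infinite (S ⧸ Q)) :
    s = t := by
  refine h.eq_of_disjoint fun s' hs' t' _ hd hc => by_contra fun h0 => ?_
  obtain ⟨K, F, -, hF, hcov⟩ := hc.exists_cover hd h0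
  have hcover : ⋃ L ∈ F, (L.comap K.subtype : Set K) = Set.univ := by
    refine Set.eq_univ_of_forall fun x => ?_
    obtain ⟨L, hL, hx⟩ := hcov x x.2
    exact Set.mem_biUnion hL hx
  obtain ⟨L, hL, hfin⟩ := Submodule.exists_finiteIndex_of_cover
    (p := fun L : Submodule S M => L.comap K.subtype) hcover
  have hfin' : Finite (K ⧸ L.comap K.subtype) :=
    (inferInstance : Finite (K ⧸ (L.comap K.subtype).toAddSubgroup))
  let Q : Ideal S := Module.annihilator S (K ⧸ L.comap K.subtype)
  have hQt : Q ≠ ⊤ := by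
    intro hQ
    refine hF L hL fun x hx => ?_
    have h1 : (1 : S) ∈ Q := hQ ▸ Submodule.mem_top
    have h2 := Module.mem_annihilator.1 h1 (Submodule.Quotient.mk ⟨x, hx⟩)
    rw [one_smul, Submodule.Quotient.mk_eq_zero] at h2
    exact h2
  have := hQ Q inferInstance hQt
  refine not_finite_iff_infinite.2 this ?_
  let g : S → (K ⧸ L.comap K.subtype) → (K ⧸ L.comap K.subtype) := fun s m => s • m
  refine Finite.of_injective (β := (K ⧸ L.comap K.subtype) → (K ⧸ L.comap K.subtype))
    (Quotient.lift g ?_) ?_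
  · intro a b hab
    have hab : a - b ∈ Q := (Submodule.quotientRel_def Q).1 hab
    funext m
    have := Module.mem_annihilator.1 hab m
    rwa [sub_smul, sub_eq_zero] at this
  · intro a b
    refine Quotient.inductionOn₂ a b fun a b hab => Quotient.sound ?_
    refine (Submodule.quotientRel_def Q).2 (Module.mem_annihilator.2 fun m => ?_)
    rw [sub_smul, sub_eq_zero]
    exact congrFun hab m

/-- Fourier-analytic cancellation: it suffices that each member is the largest submodule on which
some character is trivial. -/
theorem SameCounts.eq_of_characters [Finite M] {s t : Multiset (Submodule S M)}
    (h : SameCounts s t)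
    (hψ : ∀ K ∈ s + t, ∃ ψ : AddChar M ℂ, (∀ x ∈ K, ψ x = 1) ∧
      ∀ N : Submodule S M, (∀ x ∈ N, ψ x = 1) → N ≤ K) : s = t := by
  classical
  have := Fintype.ofFinite M
  refine h.eq_of_disjoint fun s' hs' t' ht' hd hc => by_contra fun h0 => ?_
  -- Orthogonality: a character sums to `|K|` over `K` if it is trivial there, and to zero
  -- otherwise.
  have hsum : ∀ (ψ : AddChar M ℂ) (u : Multiset (Submodule S M)),
      ∑ x : M, ψ x * (u.countP (x ∈ ·) : ℂ) =
        ((u.map fun K : Submodule S M => if ∀ x ∈ K, ψ x = 1 then Nat.card K else 0).sum : ℕ) := by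
    intro ψ u
    induction u using Multiset.induction_on with
    | empty => simp
    | cons K u ih =>
      simp only [countP_cons, map_cons, sum_cons, Nat.cast_add, mul_add, Finset.sum_add_distrib, ih]
      rw [add_comm]
      congr 1
      simp only [Nat.cast_ite, Nat.cast_one, Nat.cast_zero, mul_ite, mul_one, mul_zero]
      rw [← Finset.sum_filter, Finset.sum_subtype (p := (· ∈ K)) _ (by simp)]
      have h1 := AddChar.sum_eq_ite (ψ.compAddMonoidHom K.subtype.toAddMonoidHom)
      have h2 : ψ.compAddMonoidHom K.subtype.toAddMonoidHom = 0 ↔ ∀ x ∈ K, ψ x = 1 := by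
        rw [AddChar.ext_iff]
        simp
      simp only [h2, Nat.card_eq_fintype_card] at h1 ⊢
      exact h1
  obtain ⟨K₀, hK₀⟩ := exists_mem_of_ne_zero h0
  -- For minimal `K`, the character attached to `K` must be trivial on some `L` of the other
  -- multiset. Then `L ≤ K`, and minimality gives equality.
  obtain ⟨K, hK, hmin⟩ := (s' + t').toFinset.exists_minimal ⟨K₀, by simp [hK₀]⟩
  have key : ∀ u v : Multiset (Submodule S M), SameCounts u v → (∀ K ∈ u, K ∉ v) →
      (∀ L ∈ v, L ∈ s' + t') → K ∈ u → False := by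
    intro u v huv hd' hsub hKu
    obtain ⟨ψ, hψK, hψm⟩ := hψ K <| by
      rw [mem_toFinset, Multiset.mem_add] at hK
      rw [Multiset.mem_add]
      exact hK.imp (fun h => mem_of_le hs' h) (fun h => mem_of_le ht' h)
    have heq := hsum ψ u
    simp_rw [huv _] at heq
    rw [hsum ψ v, Nat.cast_inj] at heq
    have hpos : 0 < (u.map fun K : Submodule S M => if ∀ x ∈ K, ψ x = 1 then Nat.card K else 0).sum := by
      refine lt_of_lt_of_le ?_ (single_le_sum (fun _ _ => Nat.zero_le _) _
        (mem_map_of_mem _ hKu))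
      rw [if_pos hψK]
      exact Nat.card_pos
    rw [← heq] at hpos
    obtain ⟨n, hn, hn0⟩ : ∃ n ∈ v.map (fun K : Submodule S M => if ∀ x ∈ K, ψ x = 1 then Nat.card K else 0),
        n ≠ 0 := by
      by_contra! hcon
      exact hpos.ne' (sum_eq_zero hcon)
    obtain ⟨L, hL, rfl⟩ := mem_map.1 hn
    have hψL : ∀ x ∈ L, ψ x = 1 := by
      by_contra hcon
      exact hn0 (if_neg hcon)
    have hLK := hψm L hψL
    have := hmin (mem_toFinset.2 (hsub L hL)) hLK
    exact hd' K hKu (le_antisymm hLK this ▸ hL)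
  rw [mem_toFinset, Multiset.mem_add] at hK
  rcases hK with hK | hK
  · exact key s' t' hc hd (fun L hL => by simp [hL]) hK
  · exact key t' s' hc.symm (fun K h1 h2 => hd K h2 h1) (fun L hL => by simp [hL]) hK

end Cancellation

end WeightedPoset

namespace WeightedPoset

universe u v

/-! ### Generating characters of finite modules with cyclic socle -/

section GeneratingCharacters

variable (S : Type u) [Ring S]

/-- A character is generating if its kernel contains no nonzero submodule. -/
def IsGenerating {M : Type v} [AddCommGroup M] [Module S M] (ρ : AddChar M ℂ) : Prop :=
  ∀ N : Submodule S M, (∀ x ∈ N, ρ x = 1) → N = ⊥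

variable {S}

theorem IsGenerating.comp_equiv {M N : Type*} [AddCommGroup M] [Module S M] [AddCommGroup N]
    [Module S N] {ρ : AddChar N ℂ} (h : IsGenerating S ρ) (e : M ≃ₗ[S] N) :
    IsGenerating S (ρ.compAddMonoidHom (e : M →ₗ[S] N).toAddMonoidHom) := by
  intro A hA
  have := h (A.map (e : M →ₗ[S] N)) (by
    rintro _ ⟨x, hx, rfl⟩
    exact hA x hx)
  exact (Submodule.map_eq_bot_iff (e := e)).1 this

/-- Between simple modules, the numbers of homomorphisms in both directions agree. -/
theorem card_hom_comm_of_isSimple (A T : Type*) [AddCommGroup A] [Module S A] [AddCommGroup T]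
    [Module S T] [IsSimpleModule S A] [IsSimpleModule S T] :
    Nat.card (T →ₗ[S] A) = Nat.card (A →ₗ[S] T) := by
  by_cases h : Nonempty (T ≃ₗ[S] A)
  · obtain ⟨e⟩ := h
    refine Nat.card_congr ⟨fun f => (e.symm : A →ₗ[S] T) ∘ₗ f ∘ₗ (e.symm : A →ₗ[S] T),
      fun f => (e : T →ₗ[S] A) ∘ₗ f ∘ₗ (e : T →ₗ[S] A), fun f => ?_, fun f => ?_⟩ <;>
    · ext x
      simp
  · have h1 : ∀ f : T →ₗ[S] A, f = 0 := fun f =>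
      f.bijective_or_eq_zero.resolve_left fun hf => h ⟨LinearEquiv.ofBijective f hf⟩
    have h2 : ∀ f : A →ₗ[S] T, f = 0 := fun f =>
      f.bijective_or_eq_zero.resolve_left fun hf => h ⟨(LinearEquiv.ofBijective f hf).symm⟩
    have : Unique (T →ₗ[S] A) := ⟨⟨0⟩, h1⟩
    have : Unique (A →ₗ[S] T) := ⟨⟨0⟩, h2⟩
    rw [Nat.card_unique, Nat.card_unique]

/-- A nontrivial finite semisimple module splits off a simple submodule. -/
theorem exists_simple_isCompl (M : Type*) [AddCommGroup M] [Module S M] [Finite M]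
    [IsSemisimpleModule S M] [Nontrivial M] :
    ∃ A B : Submodule S M, IsSimpleModule S A ∧ IsCompl A B ∧ Nat.card B < Nat.card M := by
  obtain ⟨A, hA⟩ := IsAtomic.exists_atom (Submodule S M)
  obtain ⟨B, hB⟩ := exists_isCompl A
  refine ⟨A, B, isSimpleModule_iff_isAtom.2 hA, hB, ?_⟩
  refine Finite.card_subtype_lt (p := (· ∈ B)) (x := ?_) ?_
  · exact (Submodule.exists_mem_ne_zero_of_ne_bot hA.1).choose
  · intro h
    have hs := (Submodule.exists_mem_ne_zero_of_ne_bot hA.1).choose_spec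
    exact hs.2 (Submodule.disjoint_def.1 hB.disjoint _ hs.1 h)

/-- Both counts are multiplicative over direct sums in `M`, which reduces to simple `M`. The use is
to bound maps `T → M` by maps `M → T`, which are determined by their value at a generator of `M`. -/
theorem card_hom_comm (T : Type*) [AddCommGroup T] [Module S T] [IsSimpleModule S T]
    (M : Type v) [AddCommGroup M] [Module S M] [Finite M] [IsSemisimpleModule S M] :
    Nat.card (T →ₗ[S] M) = Nat.card (M →ₗ[S] T) := by
  induction hn : Nat.card M using Nat.strong_induction_on generalizing M with
  | _ n ih =>
    rcases subsingleton_or_nontrivial M with hM | hM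
    · have : Subsingleton (T →ₗ[S] M) := ⟨fun f g => LinearMap.ext fun x => Subsingleton.elim _ _⟩
      have : Subsingleton (M →ₗ[S] T) := ⟨fun f g => LinearMap.ext fun x => by
        rw [Subsingleton.elim x 0, map_zero, map_zero]⟩
      rw [Nat.card_of_subsingleton 0, Nat.card_of_subsingleton 0]
    · obtain ⟨A, B, hA, hAB, hlt⟩ := exists_simple_isCompl (S := S) M
      let e := Submodule.prodEquivOfIsCompl A B hAB
      have h1 : Nat.card (T →ₗ[S] M) = Nat.card (T →ₗ[S] A) * Nat.card (T →ₗ[S] B) := by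
        rw [← Nat.card_prod]
        refine Nat.card_congr (Equiv.trans ⟨fun f => (e.symm : M →ₗ[S] A × B) ∘ₗ f,
          fun f => (e : A × B →ₗ[S] M) ∘ₗ f, fun f => ?_, fun f => ?_⟩
          (LinearMap.prodEquiv ℕ).symm.toEquiv) <;>
        · refine LinearMap.ext fun x => ?_
          simp
      have h2 : Nat.card (M →ₗ[S] T) = Nat.card (A →ₗ[S] T) * Nat.card (B →ₗ[S] T) := by
        rw [← Nat.card_prod]
        refine Nat.card_congr (Equiv.trans ⟨fun f => f ∘ₗ (e : A × B →ₗ[S] M),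
          fun f => f ∘ₗ (e.symm : M →ₗ[S] A × B), fun f => ?_, fun f => ?_⟩
          (LinearMap.coprodEquiv ℕ).symm.toEquiv) <;>
        · refine LinearMap.ext fun x => ?_
          simp
      rw [h1, h2, card_hom_comm_of_isSimple, ih _ (hn ▸ hlt) B rfl]

/-- A generating character extends over a simple summand of a cyclic semisimple module. -/
theorem exists_isGenerating_prod (T M : Type*) [AddCommGroup T] [Module S T] [Finite T]
    [IsSimpleModule S T] [AddCommGroup M] [Module S M] [Finite M] [IsSemisimpleModule S M]
    (z : T × M) (hz : ∀ y : T × M, ∃ s : S, s • z = y)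
    (ρ : AddChar M ℂ) (hρ : IsGenerating S ρ) :
    ∃ ψ : AddChar (T × M) ℂ, IsGenerating S ψ := by
  have := Fintype.ofFinite T
  have hfin1 : Finite (T →ₗ[S] M) := DFunLike.finite _
  have hfin2 : Finite (M →ₗ[S] T) := DFunLike.finite _
  -- A map `g : M → T` is determined by `g z.2`, and this value is never `z.1`: otherwise the graph
  -- of `g` would contain the generator `z`, hence all of `T × M`. So there are at most `|T| - 1`
  -- such maps, against `|T|` characters.
  have hlt : Nat.card (T →ₗ[S] M) < Nat.card (AddChar T ℂ) := by
    rw [card_hom_comm, Nat.card_eq_fintype_card (α := AddChar T ℂ), AddChar.card_eq,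
      ← Nat.card_eq_fintype_card]
    rw [← Nat.card_congr (Equiv.Set.univ T)]
    refine (Nat.card_le_card_of_injective (β := ({z.1}ᶜ : Set T))
      (fun g : M →ₗ[S] T => ⟨g z.2, fun hg => ?_⟩) ?_).trans_lt
      (Set.ncard_lt_ncard (Set.ssubset_univ_iff.2 (by simp)))
    rotate_left
    · intro g g' hgg
      have hgg : g z.2 = g' z.2 := congrArg Subtype.val hgg
      ext m
      obtain ⟨s, hs⟩ := hz (0, m)
      have : s • z.2 = m := congrArg Prod.snd hs
      rw [← this, map_smul, map_smul]
      exact congrArg (s • ·) hgg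
    · have hg : g z.2 = z.1 := hg
      have := IsSimpleModule.nontrivial S T
      obtain ⟨t, ht⟩ := exists_ne (0 : T)
      obtain ⟨s, hs⟩ := hz (t, 0)
      have h1 : s • z.1 = t := congrArg Prod.fst hs
      have h2 : s • z.2 = 0 := congrArg Prod.snd hs
      rw [← hg, ← map_smul, h2, map_zero] at h1
      exact ht h1.symm
  obtain ⟨τ, hτ⟩ : ∃ τ : AddChar T ℂ, ∀ h : T →ₗ[S] M,
      τ ≠ (ρ.compAddMonoidHom h.toAddMonoidHom)⁻¹ := by
    by_contra! hcon
    exact hlt.not_ge (Nat.card_le_card_of_surjective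
      (fun h : T →ₗ[S] M => (ρ.compAddMonoidHom h.toAddMonoidHom)⁻¹)
      fun τ => (hcon τ).imp fun _ h => h.symm)
  refine ⟨τ.compAddMonoidHom (AddMonoidHom.fst T M) * ρ.compAddMonoidHom (AddMonoidHom.snd T M),
    fun N hN => ?_⟩
  have hN : ∀ x ∈ N, τ x.1 * ρ x.2 = 1 := hN
  -- The part of `N` inside `M` is trivial because `ρ` is generating. Hence `N` is zero or the graph
  -- of some `h : T → M`; the graph would make `τ` the inverse of `ρ ∘ h`, which the choice of `τ`
  -- excludes.
  have hinj : Function.Injective (LinearMap.fst S T M ∘ₗ N.subtype) := by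
    rw [← LinearMap.ker_eq_bot, LinearMap.ker_eq_bot']
    intro x hx
    have hx : (x : T × M).1 = 0 := hx
    have hb := hρ (N.comap (LinearMap.inr S T M)) (by
      intro m hm
      simpa using hN (0, m) hm)
    have hm : (x : T × M).2 ∈ N.comap (LinearMap.inr S T M) := by
      change ((0 : T), (x : T × M).2) ∈ N
      rw [← hx]
      exact x.2
    rw [hb, Submodule.mem_bot] at hm
    exact Subtype.ext (Prod.ext hx hm)
  rcases LinearMap.surjective_or_eq_zero (LinearMap.fst S T M ∘ₗ N.subtype) with hs | h0
  · exfalso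
    let e := LinearEquiv.ofBijective _ ⟨hinj, hs⟩
    refine hτ (LinearMap.snd S T M ∘ₗ N.subtype ∘ₗ (e.symm : T →ₗ[S] N)) ?_
    refine eq_inv_of_mul_eq_one_left (DFunLike.ext _ _ fun t => ?_)
    have h1 := hN _ (e.symm t).2
    have h2 : ((e.symm t : N) : T × M).1 = t := e.apply_symm_apply t
    rw [h2] at h1
    simpa using h1
  · refine (Submodule.eq_bot_iff N).2 fun x hx => ?_
    have := hinj (a₁ := ⟨x, hx⟩) (a₂ := 0) (by rw [h0]; rfl)
    exact congrArg Subtype.val this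

/-- A finite cyclic semisimple module has a generating character. -/
theorem exists_isGenerating_of_isSemisimple (M : Type v) [AddCommGroup M] [Module S M] [Finite M]
    [IsSemisimpleModule S M] (z : M) (hz : ∀ y : M, ∃ s : S, s • z = y) :
    ∃ ψ : AddChar M ℂ, IsGenerating S ψ := by
  induction hn : Nat.card M using Nat.strong_induction_on generalizing M with
  | _ n ih =>
    rcases subsingleton_or_nontrivial M with hM | hM
    · exact ⟨1, fun N _ => Subsingleton.elim _ _⟩
    · obtain ⟨A, B, hA, hAB, hlt⟩ := exists_simple_isCompl (S := S) M
      let e := Submodule.prodEquivOfIsCompl A B hAB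
      have hz' : ∀ y : A × B, ∃ s : S, s • e.symm z = y := fun y => by
        obtain ⟨s, hs⟩ := hz (e y)
        exact ⟨s, by rw [← map_smul, hs, e.symm_apply_apply]⟩
      obtain ⟨ρ, hρ⟩ := ih _ (hn ▸ hlt) B (e.symm z).2 (fun y => by
        obtain ⟨s, hs⟩ := hz' (0, y)
        exact ⟨s, congrArg Prod.snd hs⟩) rfl
      obtain ⟨ψ, hψ⟩ := exists_isGenerating_prod A B (e.symm z) hz' ρ hρ
      exact ⟨_, hψ.comp_equiv e.symm⟩

/-- Complex characters extend from subgroups of finite abelian groups. -/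
theorem exists_addChar_extension {G : Type*} [AddCommGroup G] [Finite G] (K : AddSubgroup G)
    (χ : AddChar K ℂ) : ∃ ψ : AddChar G ℂ, ∀ x : K, ψ x = χ x := by
  have : NeZero (Monoid.exponent (Multiplicative G)) := ⟨Monoid.exponent_ne_zero_of_finite⟩
  let χ' : (AddSubgroup.toSubgroup K) →* ℂˣ := MonoidHom.toHomUnits
    { toFun := fun x => χ ⟨x.1.toAdd, x.2⟩
      map_one' := χ.map_zero_eq_one
      map_mul' := fun x y => χ.map_add_eq_mul ⟨x.1.toAdd, x.2⟩ ⟨y.1.toAdd, y.2⟩ }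
  obtain ⟨ψ, hψ⟩ := MonoidHom.domRestrict_surjective ℂ
    (AddSubgroup.toSubgroup K) χ'
  refine ⟨AddChar.toMonoidHomEquiv.symm ((Units.coeHom ℂ).comp ψ), fun x => ?_⟩
  have := DFunLike.congr_fun hψ ⟨Multiplicative.ofAdd x.1, x.2⟩
  exact congrArg Units.val this

/-- A finite module with cyclic socle has a generating character. -/
theorem exists_isGenerating (M : Type*) [AddCommGroup M] [Module S M] [Finite M]
    (h : (socle S M).IsPrincipal) : ∃ ψ : AddChar M ℂ, IsGenerating S ψ := by
  have hss : IsSemisimpleModule S (socle S M) := (isGreatest_socle S M).1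
  obtain ⟨z, hz⟩ := h
  have hzmem : z ∈ socle S M := by
    rw [hz]
    exact Submodule.mem_span_singleton_self z
  obtain ⟨χ, hχ⟩ := exists_isGenerating_of_isSemisimple (S := S) (socle S M) ⟨z, hzmem⟩ <| by
    rintro ⟨y, hy⟩
    have hy' := hy
    rw [hz, Submodule.mem_span_singleton] at hy'
    obtain ⟨s, hs⟩ := hy'
    exact ⟨s, Subtype.ext hs⟩
  obtain ⟨ψ, hψ⟩ := exists_addChar_extension (socle S M).toAddSubgroup χ
  refine ⟨ψ, fun N hN => by_contra fun h0 => ?_⟩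
  -- A nonzero submodule contains a simple one, which lies in the socle, where `χ` is already
  -- generating.
  obtain ⟨A, hA, hAN⟩ := (IsAtomic.eq_bot_or_exists_atom_le N).resolve_left h0
  have hsimple : IsSimpleModule S A := isSimpleModule_iff_isAtom.2 hA
  have hAs : A ≤ socle S M :=
    (isGreatest_socle S M).2 (inferInstanceAs (IsSemisimpleModule S A))
  have hbot := hχ (A.comap (socle S M).subtype) fun x hx => by
    rw [← hψ x]
    exact hN _ (hAN hx)
  refine hA.1 ((Submodule.eq_bot_iff A).2 fun x hx => ?_)
  have : (⟨x, hAs hx⟩ : socle S M) ∈ A.comap (socle S M).subtype := hx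
  rw [hbot, Submodule.mem_bot] at this
  exact congrArg Subtype.val this

end GeneratingCharacters

end WeightedPoset

namespace WeightedPoset

open Multiset

/-! ### Möbius inversion and the bound by `zetaNum` -/

section Zeta

open Classical in
theorem sum_countP_eq {α β : Type*} [Fintype β] (φ : α → β) (p : β → Prop) (s : Multiset α) :
    ∑ U : β with p U, s.countP (φ · = U) = s.countP (fun K => p (φ K)) := by
  induction s using Multiset.induction_on with
  | empty => simp
  | cons K s ih =>
    simp only [countP_cons, Finset.sum_add_distrib, ih]
    congr 1
    simp [Finset.sum_ite_eq]

variable {S X : Type*} [Ring S] [AddCommGroup X] [Module S X] [Finite X]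

open Classical in
theorem zetaNum_le (W : Submodule S X) (hW : ¬ W.IsPrincipal) :
    letI : Fintype (Submodule S X) := Fintype.ofFinite _
    zetaNum S X ≤ (1 / 2 : ℝ) * ∑ U : Submodule S X with U ≤ W,
      |(submoduleMoebius S X U W : ℝ)| := by
  refine csInf_le ⟨0, ?_⟩ ⟨W, hW, rfl⟩
  rintro _ ⟨V, -, rfl⟩
  positivity

/-- Let `b V` be the signed number of members above `V`, and take `W` minimal with `b W ≠ 0`. Let `c
U` be the signed number of members meeting `W` exactly in `U`. Möbius inversion gives `c U = μ(U, W)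
* b W`, so the sum of `|μ(U, W)|` is at most that of `|c U|`, hence at most twice the number of
members. -/
theorem SameCounts.eq_of_card_lt_zetaNum {s t : Multiset (Submodule S X)}
    (h : SameCounts s t) (hcard : (s.card : ℝ) < zetaNum S X) : s = t := by
  classical
  refine h.eq_of_disjoint fun s' hs' t' _ hd hc => by_contra fun h0 => ?_
  let _ : Fintype (Submodule S X) := Fintype.ofFinite _
  let _ : LocallyFiniteOrder (Submodule S X) := Fintype.toLocallyFiniteOrder
  obtain ⟨V₀, hV₀⟩ := exists_countP_le_ne hd h0
  let b : Submodule S X → ℤ := fun V => (s'.countP (V ≤ ·) : ℤ) - (t'.countP (V ≤ ·) : ℤ)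
  obtain ⟨W, hW, hmin⟩ := (Finset.univ.filter fun V => b V ≠ 0).exists_minimal
    ⟨V₀, by simpa [b, sub_eq_zero] using hV₀⟩
  have hbW : b W ≠ 0 := (Finset.mem_filter.1 hW).2
  -- Lying above a cyclic submodule means containing its generator, so `b` vanishes there by
  -- equality of counts.
  have hWp : ¬ W.IsPrincipal := by
    rintro ⟨x, hx⟩
    refine hbW ?_
    have hx : W = S ∙ x := hx
    simp only [b, hx, Submodule.span_singleton_le_iff_mem]
    rw [sub_eq_zero, Nat.cast_inj]
    convert hc x
  let c : Submodule S X → ℤ := fun U =>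
    (s'.countP (· ⊓ W = U) : ℤ) - (t'.countP (· ⊓ W = U) : ℤ)
  have hsum : ∀ p : Submodule S X → Prop, ∑ U : Submodule S X with p U, c U =
      (s'.countP (fun K => p (K ⊓ W)) : ℤ) - (t'.countP (fun K => p (K ⊓ W)) : ℤ) := by
    intro p
    simp only [c, Finset.sum_sub_distrib]
    rw [← sum_countP_eq (· ⊓ W) p s', ← sum_countP_eq (· ⊓ W) p t']
    push_cast
    rfl
  -- For `V ≤ W` the sum is `b V`, which is zero by minimality unless `V = W`; for other `V` no
  -- intersection with `W` lies above `V`.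
  have hg : ∀ V : Submodule S X, (if V = W then b W else 0) = ∑ U ∈ Finset.Ici V, c U := by
    intro V
    have hI : Finset.Ici V = Finset.univ.filter (V ≤ ·) := by
      ext
      simp
    rw [hI, hsum (V ≤ ·)]
    by_cases hVW : V ≤ W
    · have hV : (s'.countP (fun K => V ≤ K ⊓ W) : ℤ) - (t'.countP (fun K => V ≤ K ⊓ W) : ℤ)
          = b V := by
        simp only [b, le_inf_iff, hVW, and_true]
      rw [hV]
      split_ifs with heq
      · rw [heq]
      · by_contra hne
        exact heq (le_antisymm hVW (hmin (by simpa using Ne.symm hne) hVW))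
    · have : ∀ K : Submodule S X, ¬ V ≤ K ⊓ W := fun K hK => hVW (hK.trans inf_le_right)
      rw [countP_eq_zero.2 fun K _ => this K, countP_eq_zero.2 fun K _ => this K, sub_self]
      exact if_neg fun heq => hVW (le_of_eq heq)
  have hmu : ∀ U ≤ W, c U = submoduleMoebius S X U W * b W := by
    intro U hU
    rw [IncidenceAlgebra.moebius_inversion_top c _ hg U]
    simp only [mul_ite, mul_zero, Finset.sum_ite_eq', Finset.mem_Ici, hU, if_true]
    rfl
  have hz := zetaNum_le W hWp
  have hle : ∑ U : Submodule S X with U ≤ W, |(submoduleMoebius S X U W : ℝ)| ≤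
      2 * (s'.card : ℝ) := by
    calc ∑ U : Submodule S X with U ≤ W, |(submoduleMoebius S X U W : ℝ)|
        ≤ ∑ U : Submodule S X with U ≤ W,
          ((s'.countP (· ⊓ W = U) : ℝ) + (t'.countP (· ⊓ W = U) : ℝ)) := by
          refine Finset.sum_le_sum fun U hU => ?_
          have h1 : |(submoduleMoebius S X U W)| ≤ |c U| := by
            rw [hmu U (Finset.mem_filter.1 hU).2, abs_mul]
            exact le_mul_of_one_le_right (abs_nonneg _) (Int.one_le_abs hbW)
          have h2 : |c U| ≤ (s'.countP (· ⊓ W = U) : ℤ) + (t'.countP (· ⊓ W = U) : ℤ) := by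
            simp only [c]
            rw [abs_le]
            constructor <;> linarith [Int.natCast_nonneg (s'.countP (· ⊓ W = U)),
              Int.natCast_nonneg (t'.countP (· ⊓ W = U))]
          exact_mod_cast h1.trans h2
      _ = ((s'.countP (fun K => K ⊓ W ≤ W) : ℕ) : ℝ) +
          ((t'.countP (fun K => K ⊓ W ≤ W) : ℕ) : ℝ) := by
          rw [Finset.sum_add_distrib, ← sum_countP_eq (· ⊓ W) (· ≤ W) s',
            ← sum_countP_eq (· ⊓ W) (· ≤ W) t']
          push_cast
          rfl
      _ = 2 * (s'.card : ℝ) := by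
          rw [countP_eq_card.2 fun K _ => inf_le_right, countP_eq_card.2 fun K _ => inf_le_right,
            ← hc.card_eq, two_mul]
  have hs'c : (s'.card : ℝ) ≤ s.card := by exact_mod_cast card_le_card hs'
  linarith

end Zeta

end WeightedPoset

namespace WeightedPoset

open Multiset

/-! ### Extending maps by relative and strong pseudo-injectivity -/

section Extension

variable {S D A B X Y : Type*} [Ring S] [AddCommGroup D] [Module S D] [AddCommGroup A] [Module S A]
  [AddCommGroup B] [Module S B] [AddCommGroup X] [Module S X] [AddCommGroup Y] [Module S Y]

/-- A map whose kernel contains that of `p` factors through the range of `p`. -/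
theorem exists_factor_range (p : D →ₗ[S] A) (q : D →ₗ[S] B)
    (h : LinearMap.ker p ≤ LinearMap.ker q) :
    ∃ g : LinearMap.range p →ₗ[S] B, ∀ x, g (p.rangeRestrict x) = q x := by
  refine ⟨(LinearMap.ker p).liftQ q h ∘ₗ
    (p.quotKerEquivRange.symm : LinearMap.range p →ₗ[S] D ⧸ LinearMap.ker p), fun x => ?_⟩
  have : p.quotKerEquivRange.symm (p.rangeRestrict x) = (LinearMap.ker p).mkQ x := by
    rw [LinearEquiv.symm_apply_eq]
    rfl
  simp only [LinearMap.comp_apply, LinearEquiv.coe_coe, this]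
  rfl

theorem IsRelInjective.exists_extension (hXY : IsRelInjective S X Y) (p : D →ₗ[S] X)
    (q : D →ₗ[S] Y) (h : LinearMap.ker p ≤ LinearMap.ker q) :
    ∃ g : X →ₗ[S] Y, ∀ x, g (p x) = q x := by
  obtain ⟨g₀, hg₀⟩ := exists_factor_range p q h
  obtain ⟨g, hg⟩ := hXY _ g₀
  exact ⟨g, fun x => (hg (p.rangeRestrict x)).trans (hg₀ x)⟩

/-- Equal kernels make the induced map from the range of `p` to `X` (through `e.symm`) injective, so
it extends to an automorphism. -/
theorem IsStrongPseudoInjective.exists_extension (hX : IsStrongPseudoInjective S X)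
    (e : X ≃ₗ[S] Y) (p : D →ₗ[S] X) (q : D →ₗ[S] Y) (h : LinearMap.ker p = LinearMap.ker q) :
    ∃ τ : X ≃ₗ[S] Y, ∀ x, τ (p x) = q x := by
  obtain ⟨g₀, hg₀⟩ := exists_factor_range p ((e.symm : Y →ₗ[S] X) ∘ₗ q)
    (h.le.trans (fun x hx => by
      rw [LinearMap.mem_ker] at hx ⊢
      simp [hx]))
  obtain ⟨τ, hτ⟩ := hX _ g₀ <| by
    rw [← LinearMap.ker_eq_bot, LinearMap.ker_eq_bot']
    rintro ⟨_, x, rfl⟩ hx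
    have h1 : g₀ (p.rangeRestrict x) = 0 := hx
    rw [hg₀] at h1
    have h2 : q x = 0 := by simpa using h1
    have h3 : x ∈ LinearMap.ker p := h ▸ LinearMap.mem_ker.2 h2
    exact Subtype.ext h3
  refine ⟨τ.trans e, fun x => ?_⟩
  have h1 := (hτ (p.rangeRestrict x)).trans (hg₀ x)
  have h2 : τ (p x) = e.symm (q x) := h1
  rw [LinearEquiv.trans_apply, h2, e.apply_symm_apply]

/-- Relative injectivity with respect to a finite family: a map vanishing on the common kernel of
`p i`, `i ∈ F`, is a sum of maps factoring through the `p i`. -/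
theorem exists_sum_extension {ι : Type*} {H : ι → Type*} [∀ i, AddCommGroup (H i)]
    [∀ i, Module S (H i)] (p : ∀ i, D →ₗ[S] H i) (F : Finset ι)
    (hF : ∀ i ∈ F, IsRelInjective S (H i) Y) (q : D →ₗ[S] Y)
    (hq : ∀ x, (∀ i ∈ F, p i x = 0) → q x = 0) :
    ∃ g : ∀ i, H i →ₗ[S] Y, ∀ x, ∑ i ∈ F, g i (p i x) = q x := by
  classical
  induction F using Finset.induction_on generalizing q with
  | empty => exact ⟨fun _ => 0, fun x => by simp [hq x (by simp)]⟩
  | insert a F ha ih =>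
    -- On the common kernel of the other `p i`, `q` factors through `p a`. Subtracting an extension
    -- `ga ∘ p a` makes the difference vanish there, as the induction needs.
    let D₀ : Submodule S D := ⨅ i ∈ F, LinearMap.ker (p i)
    have hD₀ : ∀ x, x ∈ D₀ ↔ ∀ i ∈ F, p i x = 0 := fun x => by
      simp [D₀, Submodule.mem_iInf]
    obtain ⟨ga, hga⟩ := (hF a (Finset.mem_insert_self a F)).exists_extension
      (p a ∘ₗ D₀.subtype) (q ∘ₗ D₀.subtype) (fun x hx => by
        refine hq _ fun i hi => ?_
        rcases Finset.mem_insert.1 hi with rfl | hi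
        · exact hx
        · exact (hD₀ x).1 x.2 i hi)
    obtain ⟨g, hg⟩ := ih (fun i hi => hF i (Finset.mem_insert_of_mem hi)) (q - ga ∘ₗ p a)
      (fun x hx => sub_eq_zero.2 (hga ⟨x, (hD₀ x).2 hx⟩).symm)
    refine ⟨Function.update g a ga, fun x => ?_⟩
    have hsum : ∑ i ∈ F, Function.update g a ga i (p i x) = ∑ i ∈ F, g i (p i x) :=
      Finset.sum_congr rfl fun i hi => by
        rw [Function.update_of_ne fun h : i = a => ha (h ▸ hi)]
    rw [Finset.sum_insert ha, Function.update_self, hsum, hg x]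
    simp

end Extension

/-! ### Hamming isometries are monomial -/

section Hamming

theorem exists_perm_of_map_univ_eq {I β : Type*} [Fintype I] {f g : I → β}
    (h : (Finset.univ : Finset I).val.map f = (Finset.univ : Finset I).val.map g) :
    ∃ σ : Equiv.Perm I, ∀ i, g (σ i) = f i := by
  classical
  have hc : ∀ b, Nonempty ({i // f i = b} ≃ {i // g i = b}) := fun b => by
    refine ⟨Fintype.equivOfCardEq ?_⟩
    have := congrArg (count b) h
    rw [count_map, count_map] at this
    rw [Fintype.card_subtype, Fintype.card_subtype]
    simpa [Finset.card, Finset.filter_val, eq_comm] using this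
  let e := fun b => (hc b).some
  exact ⟨(Equiv.sigmaFiberEquiv f).symm.trans
    ((Equiv.sigmaCongrRight e).trans (Equiv.sigmaFiberEquiv g)), fun i => (e (f i) ⟨i, rfl⟩).2⟩

variable {S I : Type*} [Ring S] [Fintype I] {H : I → Type*} [∀ i, AddCommGroup (H i)]
  [∀ i, Module S (H i)]

/-- The conditions under which kernels of coordinate maps are determined by Hamming weights. -/
def HammingCondition (S : Type*) [Ring S] {I : Type*} [Fintype I] (H : I → Type*)
    [∀ i, AddCommGroup (H i)] [∀ i, Module S (H i)] : Prop :=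
  (∀ i, Finite (H i) ∧ (socle S (H i)).IsPrincipal) ∨
  (∀ N : Submodule S (∀ i, H i), N.IsPrincipal) ∨
  (∃ _ : Finite (∀ i, H i), (Fintype.card I : ℝ) < zetaNum S (∀ i, H i)) ∨
  Fintype.card I ≤ 2 ∨
  (∀ Q : Ideal S, Q.IsTwoSided → Q ≠ ⊤ → Infinite (S ⧸ Q))

theorem HammingCondition.kernels_eq (hH : HammingCondition S H) (C : Submodule S (∀ i, H i))
    (p q : ∀ i, C →ₗ[S] H i)
    (h : SameCounts ((Finset.univ : Finset I).val.map fun i => LinearMap.ker (p i))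
      ((Finset.univ : Finset I).val.map fun i => LinearMap.ker (q i))) :
    ((Finset.univ : Finset I).val.map fun i => LinearMap.ker (p i)) =
      ((Finset.univ : Finset I).val.map fun i => LinearMap.ker (q i)) := by
  classical
  rcases hH with h1 | h2 | ⟨hfin, h3⟩ | h4 | h5
  · have := fun i => (h1 i).1
    refine h.eq_of_characters fun K hK => ?_
    have key : ∀ (i : I) (r : C →ₗ[S] H i), ∃ ψ : AddChar C ℂ,
        (∀ x ∈ LinearMap.ker r, ψ x = 1) ∧
          ∀ N : Submodule S C, (∀ x ∈ N, ψ x = 1) → N ≤ LinearMap.ker r := by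
      intro i r
      obtain ⟨ρ, hρ⟩ := exists_isGenerating (S := S) (H i) (h1 i).2
      refine ⟨ρ.compAddMonoidHom r.toAddMonoidHom, fun x hx => ?_, fun N hN => ?_⟩
      · simp [LinearMap.mem_ker.1 hx]
      · have := hρ (N.map r) (by
          rintro _ ⟨x, hx, rfl⟩
          exact hN x hx)
        exact LinearMap.le_ker_iff_map.2 this
    rw [Multiset.mem_add, mem_map, mem_map] at hK
    rcases hK with ⟨i, -, rfl⟩ | ⟨i, -, rfl⟩
    · exact key i (p i)
    · exact key i (q i)
  · refine h.eq_of_forall_isPrincipal fun N => ?_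
    obtain ⟨x, hx⟩ := h2 (N.map C.subtype)
    have hxm : x ∈ N.map C.subtype := hx ▸ Submodule.mem_span_singleton_self x
    obtain ⟨y, hy, rfl⟩ := hxm
    refine ⟨y, Submodule.map_injective_of_injective C.injective_subtype ?_⟩
    rw [hx, Submodule.map_span, Set.image_singleton]
  · refine Multiset.map_injective
      -- The bound concerns the whole product, so the kernels are pushed forward from `C`; points
      -- outside `C` then count zero on both sides.
      (Submodule.map_injective_of_injective C.injective_subtype) ?_
    refine SameCounts.eq_of_card_lt_zetaNum (S := S) (X := ∀ i, H i) ?_ (by simpa using h3)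
    intro x
    by_cases hx : x ∈ C
    · have hmem : ∀ K : Submodule S C, x ∈ K.map C.subtype ↔ (⟨x, hx⟩ : C) ∈ K := by
        intro K
        simp [hx]
      have := h ⟨x, hx⟩
      rw [countP_map, countP_map, ← countP_eq_card_filter, ← countP_eq_card_filter]
      simp only [hmem]
      convert this
    · rw [countP_eq_zero.2, countP_eq_zero.2] <;>
      · intro K hK hxK
        obtain ⟨K, -, rfl⟩ := mem_map.1 hK
        exact hx (Submodule.map_subtype_le C K hxK)
  · exact h.eq_of_card_le_two (by simpa using h4)
  · exact h.eq_of_infinite_quotients h5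

/-- Maps with equal Hamming weights differ by a monomial transformation. -/
theorem HammingCondition.exists_monomial (hH : HammingCondition S H)
    (hA : ∀ i, IsStrongPseudoInjective S (H i)) (hiso : ∀ i j, Nonempty (H i ≃ₗ[S] H j))
    {D : Type*} [AddCommGroup D] [Module S D] (p q : ∀ i, D →ₗ[S] H i)
    (h : ∀ x, {i | p i x = 0}.ncard = {i | q i x = 0}.ncard) :
    ∃ (σ : Equiv.Perm I) (e : ∀ i, H i ≃ₗ[S] H (σ i)), ∀ i x, e i (p i x) = q (σ i) x := by
  classical
  let P := LinearMap.pi p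
  let Q := LinearMap.pi q
  have hker : LinearMap.ker P ≤ LinearMap.ker Q := by
    intro x hx
    have hx : ∀ i, p i x = 0 := fun i => congrFun hx i
    have h1 := h x
    have : {i | p i x = 0} = Set.univ := Set.eq_univ_of_forall hx
    rw [this, Set.ncard_univ] at h1
    have h2 : {i | q i x = 0} = Set.univ := Set.eq_of_subset_of_ncard_le (Set.subset_univ _)
      (by rw [← h1, Set.ncard_univ])
    funext i
    exact (h2 ▸ Set.mem_univ i : i ∈ {i | q i x = 0})
  -- Replacing `D` by its image under `P` gives a genuine code in the product, to which the Hamming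
  -- condition applies.
  obtain ⟨g, hg⟩ := exists_factor_range P Q hker
  have hcount : ∀ (r : ∀ i, LinearMap.range P →ₗ[S] H i) (x : LinearMap.range P),
      countP (x ∈ ·) ((Finset.univ : Finset I).val.map fun i => LinearMap.ker (r i)) =
        {i | r i x = 0}.ncard := by
    intro r x
    rw [countP_map, Set.ncard_eq_toFinset_card', Set.toFinset_ofPred]
    rfl
  have heq := hH.kernels_eq (LinearMap.range P)
    (fun i => LinearMap.proj i ∘ₗ (LinearMap.range P).subtype) (fun i => LinearMap.proj i ∘ₗ g) <| by
    rintro ⟨_, x, rfl⟩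
    have h1 := hcount (fun i => LinearMap.proj i ∘ₗ (LinearMap.range P).subtype)
      (P.rangeRestrict x)
    have h2 := hcount (fun i => LinearMap.proj i ∘ₗ g) (P.rangeRestrict x)
    have h3 : {i | (LinearMap.proj i ∘ₗ g) (P.rangeRestrict x) = 0} = {i | q i x = 0} := by
      ext i
      simp only [LinearMap.comp_apply, hg]
      rfl
    rw [h3, ← h x] at h2
    exact (h1.trans h2.symm)
  obtain ⟨σ, hσ⟩ := exists_perm_of_map_univ_eq heq
  have hex : ∀ i, ∃ e : H i ≃ₗ[S] H (σ i), ∀ x, e (p i x) = q (σ i) x := by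
    intro i
    obtain ⟨e, he⟩ := (hA i).exists_extension (hiso i (σ i)).some _ _ (hσ i).symm
    refine ⟨e, fun x => (he (P.rangeRestrict x)).trans ?_⟩
    simp only [LinearMap.comp_apply, hg]
    rfl
  choose e he using hex
  exact ⟨σ, e, he⟩

end Hamming

end WeightedPoset

namespace WeightedPoset

/-! ### Levels of a finite poset -/

section Length

variable {Ω : Type*} [Fintype Ω] [PartialOrder Ω]

theorem card_le_len {B : Finset Ω} {y : Ω} (hB : IsChain (· ≤ ·) (B : Set Ω))
    (hy : IsGreatest (B : Set Ω) y) : B.card ≤ len y :=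
  le_csSup ⟨Fintype.card Ω, by rintro _ ⟨B, -, -, rfl⟩; exact Finset.card_le_univ B⟩
    ⟨B, hB, hy, rfl⟩

theorem exists_card_eq_len (y : Ω) : ∃ B : Finset Ω, IsChain (· ≤ ·) (B : Set Ω) ∧
    IsGreatest (B : Set Ω) y ∧ B.card = len y :=
  Nat.sSup_mem (s := {n : ℕ | ∃ B : Finset Ω,
    IsChain (· ≤ ·) (B : Set Ω) ∧ IsGreatest (B : Set Ω) y ∧ B.card = n})
    ⟨1, {y}, by simp, by simp, by simp⟩
    ⟨Fintype.card Ω, by rintro _ ⟨B, -, -, rfl⟩; exact Finset.card_le_univ B⟩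

theorem one_le_len (y : Ω) : 1 ≤ len y := by
  simpa using card_le_len (B := {y}) (y := y) (by simp) (by simp)

theorem len_le_maxChainCard (y : Ω) : len y ≤ maxChainCard Ω := by
  obtain ⟨B, hB, -, hc⟩ := exists_card_eq_len y
  exact le_csSup ⟨Fintype.card Ω, by rintro _ ⟨B, -, rfl⟩; exact Finset.card_le_univ B⟩
    ⟨B, hB, hc⟩

theorem len_strictMono : StrictMono (len : Ω → ℕ) := by
  classical
  intro u v huv
  obtain ⟨B, hB, hu, hc⟩ := exists_card_eq_len u
  have hlt : ∀ b ∈ B, b < v := fun b hb => (hu.2 hb).trans_lt huv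
  have hv : v ∉ B := fun h => (hlt v h).false
  have := card_le_len (B := insert v B) (y := v) (by
    rw [Finset.coe_insert]
    exact hB.insert fun b hb _ => Or.inr (hlt b hb).le) (by
    rw [Finset.coe_insert]
    refine ⟨Set.mem_insert _ _, ?_⟩
    rintro b (rfl | hb)
    · exact le_rfl
    · exact (hlt b hb).le)
  rw [Finset.card_insert_of_notMem hv, hc] at this
  exact this

theorem len_le_len_orderIso (σ : Ω ≃o Ω) (u : Ω) : len u ≤ len (σ u) := by
  classical
  obtain ⟨B, hB, hu, hc⟩ := exists_card_eq_len u
  rw [← hc, ← Finset.card_map σ.toEquiv.toEmbedding]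
  refine card_le_len ?_ ?_
  · rw [Finset.coe_map]
    rintro _ ⟨a, ha, rfl⟩ _ ⟨c, hc, rfl⟩ hac
    exact (hB ha hc fun h => hac (h ▸ rfl)).imp (fun h => σ.monotone h) fun h => σ.monotone h
  · rw [Finset.coe_map]
    exact σ.monotone.map_isGreatest hu

theorem len_orderIso (σ : Ω ≃o Ω) (u : Ω) : len (σ u) = len u :=
  le_antisymm (by simpa using len_le_len_orderIso σ.symm (σ u)) (len_le_len_orderIso σ u)

/-- The order is recovered from `len`, so every level-preserving permutation is an order
automorphism. -/
theorem IsHierarchical.le_iff (hP : IsHierarchical Ω) {u v : Ω} :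
    u ≤ v ↔ u = v ∨ len u < len v :=
  ⟨fun h => h.eq_or_lt.imp_right fun h => len_strictMono h,
    fun h => h.elim (fun h => h.le) fun h => hP u v h⟩

end Length

/-! ### What the weight of a word determines -/

section Weights

variable {Ω : Type*} [Fintype Ω] [PartialOrder Ω] {H : Ω → Type*} [∀ i, AddCommGroup (H i)]
  {ω : Ω → ℝ}

theorem wt_congr {α β : ∀ i, H i}
    (h : ∀ i, i ∈ lowerClosure (supp α) ↔ i ∈ lowerClosure (supp β)) : wt ω α = wt ω β := by
  classical
  exact Finset.sum_congr (Finset.filter_congr fun i _ => h i) fun _ _ => rfl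

/-- Words of equal weight have supports generating ideals conjugate under a weight-preserving
order automorphism. -/
theorem UDP.exists_orderIso (hU : UDP ω) {α β : ∀ i, H i} (h : wt ω α = wt ω β) :
    ∃ σ : Ω ≃o Ω, (∀ i, i ∈ lowerClosure (supp α) ↔ σ i ∈ lowerClosure (supp β)) ∧
      ∀ i, ω (σ i) = ω i := by
  classical
  have hlow : ∀ γ : ∀ i, H i,
      ((Finset.univ.filter fun i => i ∈ lowerClosure (supp γ) : Finset Ω) : Set Ω) =
        lowerClosure (supp γ) := fun γ => by
    ext
    simp
  obtain ⟨σ, hσ, hω⟩ := hU (Finset.univ.filter fun i => i ∈ lowerClosure (supp α))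
    (Finset.univ.filter fun i => i ∈ lowerClosure (supp β))
    (by rw [hlow]; exact (lowerClosure (supp α)).lower)
    (by rw [hlow]; exact (lowerClosure (supp β)).lower) (by
      unfold wt at h
      convert h)
  rw [hlow, hlow] at hσ
  refine ⟨σ, fun i => ?_, hω⟩
  rw [← SetLike.mem_coe (p := lowerClosure (supp β)), hσ, σ.injective.mem_set_image,
    SetLike.mem_coe]

theorem lowerClosure_supp_len_le {α : ∀ i, H i} {r : ℕ} (hα : ∀ i, r < len i → α i = 0) {i : Ω}
    (hi : i ∈ lowerClosure (supp α)) : len i ≤ r := by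
  obtain ⟨j, hj, hij⟩ := hi
  refine (len_strictMono.monotone hij).trans (not_lt.1 fun h => hj (hα j h))

/-- The generated ideals are conjugate under an order automorphism, which preserves `len`. -/
theorem UDP.vanish_above (hU : UDP ω) {α β : ∀ i, H i} (h : wt ω α = wt ω β) {r : ℕ}
    (hα : ∀ i, r < len i → α i = 0) : ∀ i, r < len i → β i = 0 := by
  intro i hi
  by_contra h0
  obtain ⟨σ, hσ, -⟩ := hU.exists_orderIso h
  have hmem : σ (σ.symm i) ∈ lowerClosure (supp β) := by
    rw [σ.apply_symm_apply]
    exact subset_lowerClosure h0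
  have := lowerClosure_supp_len_le hα ((hσ _).2 hmem)
  rw [len_orderIso] at this
  omega

/-- Nothing in the support lies strictly above level `r`, so a position of that level enters the
ideal only through its own coordinate. -/
theorem mem_lowerClosure_supp_iff {α : ∀ i, H i} {r : ℕ} (hα : ∀ i, r < len i → α i = 0) {i : Ω}
    (hi : len i = r) : i ∈ lowerClosure (supp α) ↔ α i ≠ 0 := by
  refine ⟨?_, fun h => subset_lowerClosure h⟩
  rintro ⟨j, hj, hij⟩
  rcases hij.eq_or_lt with rfl | hlt
  · exact hj
  · exact absurd (hα j (hi ▸ len_strictMono hlt)) hj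

/-- The automorphism carrying one ideal to the other preserves level and weight, so it maps the
block to itself and zeros to zeros. -/
theorem UDP.ncard_zeros_le (hU : UDP ω) {α β : ∀ i, H i} (h : wt ω α = wt ω β) {r : ℕ} (b : ℝ)
    (hα : ∀ i, r < len i → α i = 0) :
    {i : block ω r b | α i = 0}.ncard ≤ {i : block ω r b | β i = 0}.ncard := by
  have hβ := hU.vanish_above h hα
  obtain ⟨σ, hσ, hω⟩ := hU.exists_orderIso h
  have hblock : ∀ i : block ω r b, σ i ∈ block ω r b := fun i =>
    ⟨(len_orderIso σ i).trans i.2.1, (hω i).trans i.2.2⟩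
  refine Set.ncard_le_ncard_of_injOn (fun i => (⟨σ i, hblock i⟩ : block ω r b)) ?_ ?_
  · intro i hi
    have h1 := (hσ i).trans (mem_lowerClosure_supp_iff hβ (hblock i).1)
    rw [mem_lowerClosure_supp_iff hα i.2.1] at h1
    exact not_not.1 fun h2 => (h1.2 h2) hi
  · intro i _ j _ hij
    exact Subtype.ext (σ.injective (congrArg Subtype.val hij))

theorem UDP.ncard_zeros_eq (hU : UDP ω) {α β : ∀ i, H i} (h : wt ω α = wt ω β) {r : ℕ} (b : ℝ)
    (hα : ∀ i, r < len i → α i = 0) :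
    {i : block ω r b | α i = 0}.ncard = {i : block ω r b | β i = 0}.ncard :=
  le_antisymm (hU.ncard_zeros_le h b hα)
    (hU.ncard_zeros_le h.symm b (hU.vanish_above h hα))

end Weights

/-! ### Monomial and unitriangular isometries, and the extension theorem -/

section Isometries

variable {S : Type*} [Ring S] {Ω : Type*} [PartialOrder Ω] {H : Ω → Type*}
  [∀ i, AddCommGroup (H i)] [∀ i, Module S (H i)] {ω : Ω → ℝ}

/-- The monomial map given by a permutation of the positions and coordinate isomorphisms. -/
noncomputable def monomialEquiv (σ : Ω ≃o Ω) (e : ∀ i, H i ≃ₗ[S] H (σ i)) : (∀ i, H i) ≃ₗ[S] (∀ i, H i) :=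
  (LinearEquiv.piCongrRight e).trans (LinearEquiv.piCongrLeft S H σ.toEquiv)

theorem monomialEquiv_apply (σ : Ω ≃o Ω) (e : ∀ i, H i ≃ₗ[S] H (σ i)) (α : ∀ i, H i) (i : Ω) :
    monomialEquiv σ e α (σ i) = e i (α i) :=
  Equiv.piCongrLeft_apply_apply H σ.toEquiv (fun i => e i (α i)) i

variable [Fintype Ω]

theorem wt_monomialEquiv (σ : Ω ≃o Ω) (hσ : ∀ i, ω (σ i) = ω i) (e : ∀ i, H i ≃ₗ[S] H (σ i))
    (α : ∀ i, H i) : wt ω (monomialEquiv σ e α) = wt ω α := by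
  classical
  have hsupp : ∀ i, σ i ∈ supp (monomialEquiv σ e α) ↔ i ∈ supp α := fun i => by
    simp [supp, monomialEquiv_apply]
  have hmem : ∀ i, i ∈ lowerClosure (supp α) ↔ σ i ∈ lowerClosure (supp (monomialEquiv σ e α)) := by
    intro i
    rw [mem_lowerClosure, mem_lowerClosure]
    constructor
    · rintro ⟨j, hj, hij⟩
      exact ⟨σ j, (hsupp j).2 hj, σ.monotone hij⟩
    · rintro ⟨j, hj, hij⟩
      refine ⟨σ.symm j, (hsupp _).1 (by rwa [σ.apply_symm_apply]), ?_⟩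
      rwa [σ.le_symm_apply]
  symm
  refine Finset.sum_equiv σ.toEquiv (fun i => ?_) fun i _ => (hσ i).symm
  simpa using hmem i

/-- The strictly triangular endomorphism with entries `g k l` for `len k < len l`. -/
noncomputable def triangular (g : ∀ k l, H l →ₗ[S] H k) : Module.End S (∀ i, H i) :=
  LinearMap.pi fun k => ∑ l : Ω with len k < len l, g k l ∘ₗ LinearMap.proj l

theorem triangular_apply (g : ∀ k l, H l →ₗ[S] H k) (α : ∀ i, H i) (k : Ω) :
    triangular g α k = ∑ l : Ω with len k < len l, g k l (α l) := by
  simp [triangular]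

theorem triangular_apply_eq_zero (g : ∀ k l, H l →ₗ[S] H k) {α : ∀ i, H i} {k : Ω}
    (h : ∀ l, len k < len l → α l = 0) : triangular g α k = 0 := by
  rw [triangular_apply]
  exact Finset.sum_eq_zero fun l hl => by rw [h l (Finset.mem_filter.1 hl).2, map_zero]

/-- Each application reads only strictly higher levels, so coordinate `k` of the `j`-th power
vanishes once `len k + j` exceeds the largest chain. -/
theorem isNilpotent_triangular (g : ∀ k l, H l →ₗ[S] H k) : IsNilpotent (triangular g) := by
  have key : ∀ (j : ℕ) (α : ∀ i, H i) (k : Ω), maxChainCard Ω < len k + j →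
      (triangular g ^ j) α k = 0 := by
    intro j
    induction j with
    | zero => exact fun α k hk => absurd (len_le_maxChainCard k) (by omega)
    | succ j ih =>
      intro α k hk
      rw [pow_succ', Module.End.mul_apply]
      exact triangular_apply_eq_zero g fun l hl => ih α l (by omega)
  refine ⟨maxChainCard Ω + 1, LinearMap.ext fun α => funext fun k => ?_⟩
  exact key _ α k (by omega)

/-- The unitriangular automorphism with strictly triangular part `triangular g`. -/
noncomputable def unitriangularEquiv (g : ∀ k l, H l →ₗ[S] H k) : (∀ i, H i) ≃ₗ[S] (∀ i, H i) :=
  LinearEquiv.ofBijective (1 + triangular g)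
    ((Module.End.isUnit_iff _).1 (isNilpotent_triangular g).isUnit_one_add)

theorem unitriangularEquiv_apply (g : ∀ k l, H l →ₗ[S] H k) (α : ∀ i, H i) (k : Ω) :
    unitriangularEquiv g α k = α k + triangular g α k := rfl

/-- Coordinates at the top level of the support do not change, and everything on lower levels is
already in the ideal they generate. -/
theorem wt_unitriangularEquiv (hP : IsHierarchical Ω) (g : ∀ k l, H l →ₗ[S] H k)
    (α : ∀ i, H i) : wt ω (unitriangularEquiv g α) = wt ω α := by
  classical
  have h1 : ∀ i ∈ supp (unitriangularEquiv g α), ∃ j ∈ supp α, i ≤ j := by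
    intro i hi
    by_cases h0 : ∀ l, len i < len l → α l = 0
    · refine ⟨i, fun hi0 => hi ?_, le_rfl⟩
      rw [unitriangularEquiv_apply, triangular_apply_eq_zero g h0, hi0, add_zero]
    · push Not at h0
      obtain ⟨l, hl, hl0⟩ := h0
      exact ⟨l, hl0, hP i l hl⟩
  have h2 : ∀ i ∈ supp α, ∃ j ∈ supp (unitriangularEquiv g α), i ≤ j := by
    intro i hi
    obtain ⟨l, hl, hmax⟩ := (Finset.univ.filter (· ∈ supp α)).exists_max_image len
      ⟨i, by simpa using hi⟩
    have htop : ∀ j, len l < len j → α j = 0 := fun j hj => by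
      by_contra h0
      exact absurd (hmax j (Finset.mem_filter.2 ⟨Finset.mem_univ j, h0⟩)) (by omega)
    have hfix : ∀ k, len k = len l → unitriangularEquiv g α k = α k := fun k hk => by
      rw [unitriangularEquiv_apply, triangular_apply_eq_zero g fun j hj => htop j (hk ▸ hj),
        add_zero]
    rcases (hmax i (by simpa using hi)).eq_or_lt with heq | hlt
    · exact ⟨i, by rw [supp, Set.mem_ofPred_eq, hfix i heq]; exact hi, le_rfl⟩
    · refine ⟨l, ?_, hP i l hlt⟩
      rw [supp, Set.mem_ofPred_eq, hfix l rfl]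
      exact (Finset.mem_filter.1 hl).2
  refine wt_congr fun i => ?_
  rw [mem_lowerClosure, mem_lowerClosure]
  constructor
  · rintro ⟨j, hj, hij⟩
    obtain ⟨k, hk, hjk⟩ := h1 j hj
    exact ⟨k, hk, hij.trans hjk⟩
  · rintro ⟨j, hj, hij⟩
    obtain ⟨k, hk, hjk⟩ := h2 j hj
    exact ⟨k, hk, hij.trans hjk⟩

/-- A weight-preserving map acts on leading terms as a monomial isometry. -/
theorem exists_leading_monomial (hP : IsHierarchical Ω) (hA : ConditionA S H)
    (hD : ConditionD S H ω)
    (hH : ∀ r b, letI : Fintype (block ω r b) := Fintype.ofFinite _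
      HammingCondition S fun i : block ω r b => H i)
    (C : Submodule S (∀ i, H i)) (f : C →ₗ[S] (∀ i, H i))
    (hf : ∀ α : C, wt ω (f α) = wt ω (α : ∀ i, H i)) :
    ∃ (σ : Ω ≃o Ω) (e : ∀ i, H i ≃ₗ[S] H (σ i)), (∀ i, len (σ i) = len i) ∧
      (∀ i, ω (σ i) = ω i) ∧ ∀ (i : Ω) (α : C), (∀ l, len i < len l → (α : ∀ i, H i) l = 0) →
        e i ((α : ∀ i, H i) i) = f α (σ i) := by
  have hblock : ∀ r b, ∃ (σ : Equiv.Perm (block ω r b)) (e : ∀ i : block ω r b, H i ≃ₗ[S] H (σ i)),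
      ∀ (i : block ω r b) (α : C), (∀ l, r < len l → (α : ∀ i, H i) l = 0) →
        e i ((α : ∀ i, H i) i) = f α (σ i) := by
    intro r b
    let _ : Fintype (block ω r b) := Fintype.ofFinite _
    -- On the subcode vanishing above level `r`, equal weight forces equal numbers of zeros in the
    -- block.
    let D : Submodule S C := ⨅ l, ⨅ _ : r < len l, LinearMap.ker (LinearMap.proj l ∘ₗ C.subtype)
    have hDm : ∀ α : C, α ∈ D ↔ ∀ l, r < len l → (α : ∀ i, H i) l = 0 := fun α => by
      simp [D, Submodule.mem_iInf]
    let p : ∀ i : block ω r b, D →ₗ[S] H i := fun i =>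
      LinearMap.proj (i : Ω) ∘ₗ C.subtype ∘ₗ D.subtype
    let q : ∀ i : block ω r b, D →ₗ[S] H i := fun i => LinearMap.proj (i : Ω) ∘ₗ f ∘ₗ D.subtype
    obtain ⟨σ, e, he⟩ := (hH r b).exists_monomial (fun i => hA i)
      (fun i j => hD.2 i j (i.2.1.trans j.2.1.symm) (i.2.2.trans j.2.2.symm))
      p q (fun α : D => hD.1.ncard_zeros_eq (hf α.1).symm b ((hDm α.1).1 α.2))
    exact ⟨σ, e, fun i α hα => he i ⟨α, (hDm α).2 hα⟩⟩
  choose σ e he using hblock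
  let s : Ω → Ω := fun i => σ (len i) (ω i) ⟨i, rfl, rfl⟩
  have hs : ∀ r b (i : block ω r b), s i = σ r b i := by
    rintro _ _ ⟨i, rfl, rfl⟩
    rfl
  have hlen : ∀ i, len (s i) = len i := fun i => (σ (len i) (ω i) ⟨i, rfl, rfl⟩).2.1
  have hω : ∀ i, ω (s i) = ω i := fun i => (σ (len i) (ω i) ⟨i, rfl, rfl⟩).2.2
  have hinj : Function.Injective s := by
    intro i j hij
    have hi : i ∈ block ω (len j) (ω j) :=
      ⟨by rw [level, Set.mem_ofPred_eq, ← hlen i, hij, hlen], by rw [← hω i, hij, hω]⟩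
    have h1 := hs _ _ ⟨i, hi⟩
    have h2 := hs _ _ (⟨j, rfl, rfl⟩ : block ω (len j) (ω j))
    have h3 := (σ (len j) (ω j)).injective (Subtype.ext (h1.symm.trans (hij.trans h2)))
    exact congrArg Subtype.val h3
  let τ : Ω ≃o Ω :=
    { toEquiv := Equiv.ofBijective s (Finite.injective_iff_bijective.1 hinj)
      map_rel_iff' := by
        intro i j
        change s i ≤ s j ↔ i ≤ j
        rw [hP.le_iff, hP.le_iff, hlen, hlen, hinj.eq_iff] }
  exact ⟨τ, fun i => e (len i) (ω i) ⟨i, rfl, rfl⟩, hlen, hω,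
    fun i α hα => he (len i) (ω i) ⟨i, rfl, rfl⟩ α hα⟩

/-- The extension property, given that Hamming isometries of each block are monomial. -/
theorem mep_of_hammingCondition (hP : IsHierarchical Ω) (hA : ConditionA S H)
    (hB : ConditionB S H) (hD : ConditionD S H ω)
    (hH : ∀ r b, letI : Fintype (block ω r b) := Fintype.ofFinite _
      HammingCondition S fun i : block ω r b => H i) : MEP S H ω := by
  intro C f hf
  obtain ⟨σ, e, hlen, hω, he⟩ := exists_leading_monomial hP hA hD hH C f hf
  let φ := monomialEquiv σ e
  have hex : ∀ k : Ω, ∃ g : ∀ l, H l →ₗ[S] H k, ∀ α : C,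
      ∑ l : Ω with len k < len l, g l ((α : ∀ i, H i) l) =
        φ.symm (f α) k - (α : ∀ i, H i) k := by
    intro k
    -- The difference of `φ⁻¹ ∘ f` and the inclusion at `k` vanishes when all higher coordinates do,
    -- since `φ` agrees with `f` on leading terms.
    refine exists_sum_extension (H := H) (fun l => LinearMap.proj l ∘ₗ C.subtype) _ (fun l hl => ?_)
      (LinearMap.proj k ∘ₗ ((φ.symm : (∀ i, H i) →ₗ[S] (∀ i, H i)) ∘ₗ f - C.subtype))
      fun α hα => ?_
    · have hl := (Finset.mem_filter.1 hl).2
      exact hB k l (hP k l hl) fun h => hl.ne (congrArg len h)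
    · have h1 := he k α fun l hl => hα l (by simpa using hl)
      have h2 := monomialEquiv_apply σ e (φ.symm (f α)) k
      have h3 : monomialEquiv σ e (φ.symm (f α)) = f α := φ.apply_symm_apply (f α)
      rw [h3, ← h1] at h2
      exact sub_eq_zero.2 ((e k).injective h2).symm
  choose g hg using hex
  refine ⟨(unitriangularEquiv g).trans φ, fun α => ?_, fun α => ?_⟩
  · exact (wt_monomialEquiv σ hω e _).trans (wt_unitriangularEquiv hP g α)
  · have : unitriangularEquiv g (α : ∀ i, H i) = φ.symm (f α) := by
      funext k
      rw [unitriangularEquiv_apply, triangular_apply, hg, add_sub_cancel]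
    rw [LinearEquiv.trans_apply, this, φ.apply_symm_apply]

end Isometries

end WeightedPoset

theorem theorem6p3 {S : Type*} [Ring S] {Ω : Type*} [Fintype Ω] [Nonempty Ω] [PartialOrder Ω]
    (H : Ω → Type*) [∀ i, AddCommGroup (H i)] [∀ i, Module S (H i)]
    (ω : Ω → ℝ) (hω : ∀ i, 0 < ω i)
    (hP : WeightedPoset.IsHierarchical Ω)
    (hA : WeightedPoset.ConditionA S H)
    (hB : WeightedPoset.ConditionB S H)
    (hD : WeightedPoset.ConditionD S H ω)
    (h : ∀ r ∈ Set.Icc 1 (WeightedPoset.maxChainCard Ω), ∀ b ∈ ω '' WeightedPoset.level Ω r,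
      (∀ i ∈ WeightedPoset.block ω r b,
        Finite (H i) ∧ (WeightedPoset.socle S (H i)).IsPrincipal) ∨
      (∀ N : Submodule S (WeightedPoset.BlockModule H ω r b), N.IsPrincipal) ∨
      (∃ _ : Finite (WeightedPoset.BlockModule H ω r b),
        (∃ N : Submodule S (WeightedPoset.BlockModule H ω r b), ¬ N.IsPrincipal) ∧
        ((WeightedPoset.block ω r b).ncard : ℝ) ≤
          WeightedPoset.zetaNum S (WeightedPoset.BlockModule H ω r b) - 1) ∨
      (WeightedPoset.block ω r b).ncard ≤ 2 ∨
      (∀ Q : Ideal S, Q.IsTwoSided → Q ≠ ⊤ → Infinite (S ⧸ Q))) :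
    WeightedPoset.MEP S H ω := by
  refine WeightedPoset.mep_of_hammingCondition hP hA hB hD fun r b => ?_
  let _ : Fintype (WeightedPoset.block ω r b) := Fintype.ofFinite _
  have hcard : Fintype.card (WeightedPoset.block ω r b) = (WeightedPoset.block ω r b).ncard := by
    rw [← Nat.card_coe_set_eq, Nat.card_eq_fintype_card]
  change WeightedPoset.HammingCondition S fun i : WeightedPoset.block ω r b => H i
  rcases (WeightedPoset.block ω r b).eq_empty_or_nonempty with hempty | ⟨i, hi⟩
  -- The hypothesis covers only weights attained on the level; an empty block has at most two
  -- positions.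
  · refine Or.inr (Or.inr (Or.inr (Or.inl ?_)))
    rw [hcard, hempty, Set.ncard_empty]
    exact Nat.zero_le 2
  have hr : r ∈ Set.Icc 1 (WeightedPoset.maxChainCard Ω) := by
    have hir : WeightedPoset.len i = r := hi.1
    exact hir ▸ ⟨WeightedPoset.one_le_len i, WeightedPoset.len_le_maxChainCard i⟩
  rcases h r hr b ⟨i, hi⟩ with h1 | h2 | ⟨hfin, -, h3⟩ | h4 | h5
  · exact Or.inl fun j => h1 j j.2
  · exact Or.inr (Or.inl h2)
  · refine Or.inr (Or.inr (Or.inl ⟨hfin, ?_⟩))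
    rw [hcard]
    linarith
  · exact Or.inr (Or.inr (Or.inr (Or.inl (hcard.trans_le h4))))
  · exact Or.inr (Or.inr (Or.inr (Or.inr h5)))
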